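/- **Theorem.** Let $R$ be an integral domain with a non-Archimedean absolute value $|\cdot|:R\to\mathbb R$, and let $$\mathcal A_R=\Big\{\sum_{n\ge 0}c_nt^n\in R[[t]] : \lim_{M\to\infty}|c_M|\,r^M=0 \text{ for every real } r>0\Big\}$$ be the ring of entire functions over $R$, regarded as a structure for the language $L_t=\{0,1,t,+,\cdot,=\}$ in the obvious way. Then the ring of integers $(\mathbb Z;0,1,+,\cdot,=)$ is uniformly positive existentially interpretable, without parameters, in the (non-empty) class of $L_t$-structures $\mathcal A_R$, as $R$ ranges over all integral domains of characteristic zero with a non-Archimedean absolute value. Explicitly: there are positive existential $L_t$-formulas (that is, formulas built from atomic formulas by conjunction, disjunction and existential quantification only) $\phi_{\mathbb Z}(x)$, $\phi_{=}(x,y)$, $\phi_0(x)$, $\phi_1(x)$, $\phi_+(x,y,z)$, $\phi_\cdot(x,y,z)$, not depending on $R$ or $|\cdot|$, such that for every such $R$, writing $D_R\subseteq\mathcal A_R$ for the set defined by $\phi_{\mathbb Z}$, there is a surjective map $\theta_R:D_R\to\mathbb Z$ with the following properties: the sets defined in $\mathcal A_R$ by $\phi_{=},\phi_0,\phi_1,\phi_+,\phi_\cdot$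 are contained in $D_R^2,D_R,D_R,D_R^3,D_R^3$ respectively, and they are exactly the sets of tuples of elements of $D_R$ satisfying, respectively, $\theta_R(x)=\theta_R(y)$, $\theta_R(x)=0$, $\theta_R(x)=1$, $\theta_R(x)+\theta_R(y)=\theta_R(z)$ and $\theta_R(x)\theta_R(y)=\theta_R(z)$. -/

import Mathlib

universe u

namespace EntireInterp

open FirstOrder FirstOrder.Language Filter Topology

/-! ### Rings of non-Archimedean entire functions -/

section Entire

variable {R : Type u} [CommRing R]

/-- A power series `f = ∑ cₙ tⁿ` over `R` has infinite radius of convergence with respect to the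
(non-Archimedean) absolute value `v` if `v(c_M) r^M → 0` for every real `r > 0`. -/
def IsEntire (v : AbsoluteValue R ℝ) (f : PowerSeries R) : Prop :=
  ∀ r : ℝ, 0 < r → Tendsto (fun M : ℕ => v (PowerSeries.coeff M f) * r ^ M) atTop (𝓝 0)

theorem isEntire_iff_bounded (v : AbsoluteValue R ℝ) (f : PowerSeries R) :
    IsEntire v f ↔
      ∀ r : ℝ, 0 < r → ∃ C : ℝ, 0 ≤ C ∧ ∀ n : ℕ, v (PowerSeries.coeff n f) * r ^ n ≤ C := by
  constructor
  · intro h r hr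
    obtain ⟨C, hC⟩ := (h r hr).bddAbove_range
    exact ⟨max C 0, le_max_right _ _, fun n => (hC ⟨n, rfl⟩).trans (le_max_left _ _)⟩
  · intro h r hr
    obtain ⟨C, _, hC⟩ := h (2 * r) (by positivity)
    have hlim : Tendsto (fun n : ℕ => C * (1 / 2 : ℝ) ^ n) atTop (𝓝 0) := by
      simpa using (tendsto_pow_atTop_nhds_zero_of_lt_one (r := (1 / 2 : ℝ))
        (by norm_num) (by norm_num)).const_mul C
    refine squeeze_zero (fun n => mul_nonneg (v.nonneg _) (by positivity)) (fun n => ?_) hlim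
    have h1 := mul_le_mul_of_nonneg_right (hC n) (show (0 : ℝ) ≤ (1 / 2) ^ n by positivity)
    have h2 : ((2 : ℝ) * r) ^ n * (1 / 2) ^ n = r ^ n := by
      rw [← mul_pow]
      congr 1
      ring
    rwa [mul_assoc, h2] at h1

theorem IsEntire.add {v : AbsoluteValue R ℝ} {f g : PowerSeries R}
    (hf : IsEntire v f) (hg : IsEntire v g) : IsEntire v (f + g) := by
  intro r hr
  have hlim := (hf r hr).add (hg r hr)
  rw [add_zero] at hlim
  refine squeeze_zero (fun n => mul_nonneg (v.nonneg _) (by positivity)) (fun n => ?_) hlim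
  rw [map_add, ← add_mul]
  exact mul_le_mul_of_nonneg_right (v.add_le _ _) (by positivity)

theorem IsEntire.mul {v : AbsoluteValue R ℝ} (hv : IsNonarchimedean v) {f g : PowerSeries R}
    (hf : IsEntire v f) (hg : IsEntire v g) : IsEntire v (f * g) := by
  rw [isEntire_iff_bounded] at *
  intro r hr
  obtain ⟨C, hC0, hC⟩ := hf r hr
  obtain ⟨D, hD0, hD⟩ := hg r hr
  refine ⟨C * D, mul_nonneg hC0 hD0, fun n => ?_⟩
  have hne : (Finset.HasAntidiagonal.antidiagonal n).Nonempty := ⟨(0, n), by simp⟩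
  obtain ⟨⟨i, j⟩, hij, hle⟩ := IsNonarchimedean.finset_image_add_of_nonempty hv
    (fun p : ℕ × ℕ => PowerSeries.coeff p.1 f * PowerSeries.coeff p.2 g) hne
  rw [PowerSeries.coeff_mul]
  rw [Finset.HasAntidiagonal.mem_antidiagonal] at hij
  have hpow : r ^ n = r ^ i * r ^ j := by rw [← pow_add, hij]
  calc _ ≤ v (PowerSeries.coeff i f * PowerSeries.coeff j g) * r ^ n :=
        mul_le_mul_of_nonneg_right hle (by positivity)
    _ = (v (PowerSeries.coeff i f) * r ^ i) * (v (PowerSeries.coeff j g) * r ^ j) := by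
        rw [map_mul, hpow]
        ring
    _ ≤ C * D := mul_le_mul (hC i) (hD j) (mul_nonneg (v.nonneg _) (by positivity)) hC0

theorem IsEntire.of_eventually_zero {v : AbsoluteValue R ℝ} {f : PowerSeries R} (N : ℕ)
    (hf : ∀ n, N ≤ n → PowerSeries.coeff n f = 0) : IsEntire v f := by
  intro r _
  refine tendsto_const_nhds.congr' ?_
  filter_upwards [eventually_ge_atTop N] with n hn
  simp [hf n hn]

/-- The ring `𝒜_R` of power series in the variable `t` with coefficients in `R` and infinite
radius of convergence, for a non-Archimedean absolute value `v` on `R`. -/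
def entireRing (v : AbsoluteValue R ℝ) (hv : IsNonarchimedean v) : Subring (PowerSeries R) where
  carrier := {f | IsEntire v f}
  mul_mem' hf hg := IsEntire.mul hv hf hg
  add_mem' hf hg := IsEntire.add hf hg
  one_mem' := IsEntire.of_eventually_zero 1 fun n hn => by
    rw [PowerSeries.coeff_one, if_neg (by omega)]
  zero_mem' := IsEntire.of_eventually_zero 0 fun n _ => by simp
  neg_mem' {f} hf := by
    rw [← neg_one_mul]
    refine IsEntire.mul hv (IsEntire.of_eventually_zero 1 fun n hn => ?_) hf
    rw [map_neg, PowerSeries.coeff_one, if_neg (by omega), neg_zero]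

/-- The variable `t`, as an element of `𝒜_R`. -/
noncomputable def entireVar (v : AbsoluteValue R ℝ) (hv : IsNonarchimedean v) : entireRing v hv :=
  ⟨PowerSeries.X, IsEntire.of_eventually_zero 2 fun n hn => by
    rw [PowerSeries.coeff_X, if_neg (by omega)]⟩

end Entire

/-! ### Languages and structures

As usual, first-order logic is logic with equality: the symbol `=` belongs to every language and
is interpreted as equality. -/

/-- Function symbols of `{0, 1, +, ·, =}`. -/
inductive ArithFunc : ℕ → Type
  | zero : ArithFunc 0
  | one : ArithFunc 0
  | add : ArithFunc 2
  | mul : ArithFunc 2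

/-- The language `{0, 1, +, ·, =}`. -/
def arithLang : FirstOrder.Language.{0, 0} where
  Functions := ArithFunc
  Relations := fun _ => Empty

/-- Function symbols of `L_t = {0, 1, t, +, ·, =}`. -/
inductive TFunc : ℕ → Type
  | zero : TFunc 0
  | one : TFunc 0
  | t : TFunc 0
  | add : TFunc 2
  | mul : TFunc 2

/-- The language `L_t = {0, 1, t, +, ·, =}`. -/
def tLang : FirstOrder.Language.{0, 0} where
  Functions := TFunc
  Relations := fun _ => Empty

/-- The ring of integers `(ℤ; 0, 1, +, ·, =)`. -/
instance intStructure : arithLang.Structure ℤ where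
  funMap := fun {_} f => match f with
    | ArithFunc.zero => fun _ => 0
    | ArithFunc.one => fun _ => 1
    | ArithFunc.add => fun x => x 0 + x 1
    | ArithFunc.mul => fun x => x 0 * x 1
  RelMap := fun {_} r => Empty.elim r

/-- `𝒜_R` as an `L_t`-structure. -/
noncomputable instance entireStructure {R : Type u} [CommRing R] (v : AbsoluteValue R ℝ)
    (hv : IsNonarchimedean v) : tLang.Structure (entireRing v hv) where
  funMap := fun {_} f => match f with
    | TFunc.zero => fun _ => 0
    | TFunc.one => fun _ => 1
    | TFunc.t => fun _ => entireVar v hv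
    | TFunc.add => fun x => x 0 + x 1
    | TFunc.mul => fun x => x 0 * x 1
  RelMap := fun {_} r => Empty.elim r

/-- The class of `L_t`-structures `𝒜_R`, as `R` ranges over the integral domains of characteristic
zero with a non-Archimedean absolute value. -/
def charZeroEntireClass : Set (CategoryTheory.Bundled.{u} tLang.Structure) :=
  {𝔑 | ∃ (R : Type u) (_ : CommRing R) (_ : IsDomain R) (_ : CharZero R)
      (v : AbsoluteValue R ℝ) (hv : IsNonarchimedean v),
      𝔑 = ⟨entireRing v hv, entireStructure v hv⟩}

/-! ### Uniform positive existential interpretations -/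

/-- Positive existential formulas: those built from atomic formulas using only conjunctions,
disjunctions and existential quantifiers. -/
inductive IsPositiveExistential {L : FirstOrder.Language} {α : Type*} :
    ∀ {n : ℕ}, L.BoundedFormula α n → Prop
  | atomic {n : ℕ} {φ : L.BoundedFormula α n} (h : φ.IsAtomic) : IsPositiveExistential φ
  | and {n : ℕ} {φ ψ : L.BoundedFormula α n} (h₁ : IsPositiveExistential φ)
      (h₂ : IsPositiveExistential ψ) : IsPositiveExistential (φ ⊓ ψ)
  | or {n : ℕ} {φ ψ : L.BoundedFormula α n} (h₁ : IsPositiveExistential φ)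
      (h₂ : IsPositiveExistential ψ) : IsPositiveExistential (φ ⊔ ψ)
  | ex {n : ℕ} {φ : L.BoundedFormula α (n + 1)} (h : IsPositiveExistential φ) :
      IsPositiveExistential φ.ex

/-- A set of `L'`-formulas (without parameters): one formula for the domain, and one for each
symbol of `L`, including equality. An `n`-ary function symbol gets a formula in `n + 1` free
variables (for its graph); constant symbols are the case `n = 0`. -/
structure InterpretationFormulas (L L' : FirstOrder.Language) where
  domain : L'.Formula (Fin 1)
  eq : L'.Formula (Fin 2)
  func : ∀ {n : ℕ}, L.Functions n → L'.Formula (Fin (n + 1))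
  rel : ∀ {n : ℕ}, L.Relations n → L'.Formula (Fin n)

/-- Every formula of the set is positive existential. -/
structure InterpretationFormulas.IsPosEx {L L' : FirstOrder.Language}
    (Φ : InterpretationFormulas L L') : Prop where
  domain : IsPositiveExistential Φ.domain
  eq : IsPositiveExistential Φ.eq
  func : ∀ {n : ℕ} (f : L.Functions n), IsPositiveExistential (Φ.func f)
  rel : ∀ {n : ℕ} (r : L.Relations n), IsPositiveExistential (Φ.rel r)

/-- The subset of `N` defined by the domain formula. -/
def InterpretationFormulas.domainSet {L L' : FirstOrder.Language} (Φ : InterpretationFormulas L L')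
    (N : Type*) [L'.Structure N] : Set N :=
  {x | Φ.domain.Realize ![x]}

/-- `θ` is a surjection from the set defined by the domain formula in `N` onto `M` such that, for
every symbol `s` of `L`, the set defined by the formula of `s` is contained in the appropriate
power of the domain and is exactly the preimage under `θ` of the realization of `s` in `M` (the
diagonal for `=`, the graph for a function symbol). -/
structure InterpretationFormulas.Interprets {L L' : FirstOrder.Language} (Φ : InterpretationFormulas L L')
    {M : Type*} [L.Structure M] {N : Type*} [L'.Structure N]
    (θ : Φ.domainSet N → M) : Prop where
  surjective : Function.Surjective θ
  eq : ∀ x : Fin 2 → N, Φ.eq.Realize x ↔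
    ∃ h : ∀ i, x i ∈ Φ.domainSet N, θ ⟨x 0, h 0⟩ = θ ⟨x 1, h 1⟩
  func : ∀ {n : ℕ} (f : L.Functions n) (x : Fin (n + 1) → N), (Φ.func f).Realize x ↔
    ∃ h : ∀ i, x i ∈ Φ.domainSet N,
      Structure.funMap f (fun i : Fin n => θ ⟨x i.castSucc, h i.castSucc⟩) =
        θ ⟨x (Fin.last n), h (Fin.last n)⟩
  rel : ∀ {n : ℕ} (r : L.Relations n) (x : Fin n → N), (Φ.rel r).Realize x ↔
    ∃ h : ∀ i, x i ∈ Φ.domainSet N, Structure.RelMap r (fun i : Fin n => θ ⟨x i, h i⟩)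

/-- The `L`-structure `M` is uniformly positive existentially interpretable (without parameters)
in the non-empty class `𝒩` of `L'`-structures: one and the same set of positive existential
formulas works for all members of the class. -/
def UniformlyPosExInterpretable {L L' : FirstOrder.Language} (M : Type*) [L.Structure M]
    (𝒩 : Set (CategoryTheory.Bundled.{u} L'.Structure)) : Prop :=
  𝒩.Nonempty ∧ ∃ Φ : InterpretationFormulas L L', Φ.IsPosEx ∧
    ∀ 𝔑 ∈ 𝒩, ∃ θ : Φ.domainSet 𝔑 → M, Φ.Interprets θ

end EntireInterp

namespace EntireInterp

open FirstOrder FirstOrder.Language Filter Topology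

/-! ### Gauss norms -/

section Growth

variable {R : Type u} [CommRing R]

/-- The Gauss norm of `f` of radius `r` is at most `B`. -/
def GaussLE (v : AbsoluteValue R ℝ) (r : ℝ) (f : PowerSeries R) (B : ℝ) : Prop :=
  ∀ n : ℕ, v (PowerSeries.coeff n f) * r ^ n ≤ B

theorem GaussLE.add {v : AbsoluteValue R ℝ} (hv : IsNonarchimedean v) {r : ℝ} (hr : 0 < r)
    {f g : PowerSeries R} {B : ℝ} (hf : GaussLE v r f B) (hg : GaussLE v r g B) :
    GaussLE v r (f + g) B := by
  intro n
  rw [map_add]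
  rcases le_max_iff.1 (hv (PowerSeries.coeff n f) (PowerSeries.coeff n g)) with h | h
  · exact (mul_le_mul_of_nonneg_right h (by positivity)).trans (hf n)
  · exact (mul_le_mul_of_nonneg_right h (by positivity)).trans (hg n)

theorem GaussLE.mul {v : AbsoluteValue R ℝ} (hv : IsNonarchimedean v) {r : ℝ} (hr : 0 < r)
    {f g : PowerSeries R} {B C : ℝ} (hf : GaussLE v r f B) (hg : GaussLE v r g C) :
    GaussLE v r (f * g) (B * C) := by
  intro n
  have hB : 0 ≤ B := (mul_nonneg (v.nonneg _) (by positivity)).trans (hf 0)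
  have hne : (Finset.HasAntidiagonal.antidiagonal n).Nonempty := ⟨(0, n), by simp⟩
  obtain ⟨⟨i, j⟩, hij, hle⟩ := IsNonarchimedean.finset_image_add_of_nonempty hv
    (fun p : ℕ × ℕ => PowerSeries.coeff p.1 f * PowerSeries.coeff p.2 g) hne
  rw [PowerSeries.coeff_mul]
  rw [Finset.HasAntidiagonal.mem_antidiagonal] at hij
  have hpow : r ^ n = r ^ i * r ^ j := by rw [← pow_add, hij]
  calc _ ≤ v (PowerSeries.coeff i f * PowerSeries.coeff j g) * r ^ n :=
        mul_le_mul_of_nonneg_right hle (by positivity)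
    _ = (v (PowerSeries.coeff i f) * r ^ i) * (v (PowerSeries.coeff j g) * r ^ j) := by
        rw [map_mul, hpow]
        ring
    _ ≤ B * C := mul_le_mul (hf i) (hg j) (mul_nonneg (v.nonneg _) (by positivity)) hB

/-- `i` is the least index at which the Gauss norm of `f` of radius `r` is attained. -/
structure IsDominant (v : AbsoluteValue R ℝ) (r : ℝ) (f : PowerSeries R) (i : ℕ) : Prop where
  ne_zero : PowerSeries.coeff i f ≠ 0
  le : GaussLE v r f (v (PowerSeries.coeff i f) * r ^ i)
  lt : ∀ n < i, v (PowerSeries.coeff n f) * r ^ n < v (PowerSeries.coeff i f) * r ^ i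

theorem IsEntire.exists_isDominant {v : AbsoluteValue R ℝ} {f : PowerSeries R} (hf : IsEntire v f)
    (h0 : f ≠ 0) {r : ℝ} (hr : 0 < r) : ∃ i, IsDominant v r f i := by
  classical
  obtain ⟨m, hm⟩ : ∃ m, PowerSeries.coeff m f ≠ 0 := by
    by_contra! h
    exact h0 (PowerSeries.ext fun n => by simp [h n])
  have hpos : 0 < v (PowerSeries.coeff m f) * r ^ m := mul_pos (v.pos hm) (by positivity)
  obtain ⟨N, hN⟩ := eventually_atTop.1 ((hf r hr).eventually_lt_const hpos)
  obtain ⟨k, -, hk⟩ := (Finset.range (N + m + 1)).exists_max_image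
    (fun n => v (PowerSeries.coeff n f) * r ^ n) ⟨0, by simp⟩
  have hmax : ∃ k, GaussLE v r f (v (PowerSeries.coeff k f) * r ^ k) := by
    refine ⟨k, fun n => ?_⟩
    by_cases hn : n < N + m + 1
    · exact hk n (by simpa using hn)
    · exact (hN n (by omega)).le.trans (hk m (Finset.mem_range.2 (by omega)))
  refine ⟨Nat.find hmax, fun h => ?_, Nat.find_spec hmax, fun n hn => ?_⟩
  · have := Nat.find_spec hmax m
    rw [h, map_zero, zero_mul] at this
    exact this.not_gt hpos
  · have h1 := Nat.find_min hmax hn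
    simp only [GaussLE, not_forall, not_le] at h1
    obtain ⟨l, hl⟩ := h1
    exact hl.trans_le (Nat.find_spec hmax l)

theorem IsDominant.mul_le {v : AbsoluteValue R ℝ} (hv : IsNonarchimedean v) {r : ℝ} (hr : 0 < r)
    {f g : PowerSeries R} {i j : ℕ} (hf : IsDominant v r f i) (hg : IsDominant v r g j) {B : ℝ}
    (hB : GaussLE v r (f * g) B) :
    (v (PowerSeries.coeff i f) * r ^ i) * (v (PowerSeries.coeff j g) * r ^ j) ≤ B := by
  have key : v (PowerSeries.coeff (i + j) (f * g)) =
      v (PowerSeries.coeff i f * PowerSeries.coeff j g) := by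
    rw [PowerSeries.coeff_mul]
    refine hv.apply_sum_eq_of_lt (fun a => (v.map_neg a).symm)
      (l := fun p : ℕ × ℕ => PowerSeries.coeff p.1 f * PowerSeries.coeff p.2 g)
      (k := (i, j)) (by simp) ?_
    rintro ⟨a, b⟩ hab hne
    rw [Finset.HasAntidiagonal.mem_antidiagonal] at hab
    have hpow : r ^ a * r ^ b = r ^ i * r ^ j := by rw [← pow_add, hab, pow_add]
    have hfi : 0 < v (PowerSeries.coeff i f) * r ^ i :=
      mul_pos (v.pos hf.ne_zero) (by positivity)
    have hgj : 0 < v (PowerSeries.coeff j g) * r ^ j :=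
      mul_pos (v.pos hg.ne_zero) (by positivity)
    have hfa : 0 ≤ v (PowerSeries.coeff a f) * r ^ a := mul_nonneg (v.nonneg _) (by positivity)
    have hga : 0 ≤ v (PowerSeries.coeff b g) * r ^ b := mul_nonneg (v.nonneg _) (by positivity)
    have hlt : (v (PowerSeries.coeff a f) * r ^ a) * (v (PowerSeries.coeff b g) * r ^ b) <
        (v (PowerSeries.coeff i f) * r ^ i) * (v (PowerSeries.coeff j g) * r ^ j) := by
      rcases lt_or_ge a i with h | h
      · exact (mul_le_mul_of_nonneg_left (hg.le b) hfa).trans_lt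
          (mul_lt_mul_of_pos_right (hf.lt a h) hgj)
      · have hb : b < j := by
          rcases h.eq_or_lt with rfl | h
          · exact absurd (by simp; omega) hne
          · omega
        exact (mul_le_mul_of_nonneg_right (hf.le a) hga).trans_lt
          (mul_lt_mul_of_pos_left (hg.lt b hb) hfi)
    refine lt_of_mul_lt_mul_right (a := r ^ i * r ^ j) ?_ (by positivity)
    calc _ = (v (PowerSeries.coeff a f) * r ^ a) * (v (PowerSeries.coeff b g) * r ^ b) := by
          rw [← hpow, map_mul]; ring
      _ < _ := hlt
      _ = _ := by rw [map_mul]; ring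
  have h := hB (i + j)
  rw [key, map_mul, pow_add] at h
  linarith

/-- A power series whose Gauss norms of large radius are at most `1` is constant. -/
theorem eq_C_of_gaussLE_one {v : AbsoluteValue R ℝ} {g : PowerSeries R} {r₀ : ℝ}
    (h : ∀ r, r₀ ≤ r → GaussLE v r g 1) :
    g = PowerSeries.C (PowerSeries.coeff 0 g) := by
  ext n
  rcases n.eq_zero_or_pos with rfl | hn
  · simp
  rw [PowerSeries.coeff_C, if_neg hn.ne', ← v.eq_zero]
  by_contra hne
  have hpos : 0 < v (PowerSeries.coeff n g) := lt_of_le_of_ne (v.nonneg _) (Ne.symm hne)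
  have hlim : Tendsto (fun r : ℝ => v (PowerSeries.coeff n g) * r ^ n) atTop atTop :=
    (tendsto_pow_atTop hn.ne').const_mul_atTop hpos
  obtain ⟨r, hr1, hr2⟩ := ((hlim.eventually_gt_atTop 1).and (eventually_ge_atTop r₀)).exists
  exact (h r hr2 n).not_gt hr1

end Growth

section Derivative

variable {R : Type u} [CommRing R] [IsDomain R]

theorem natCast_le_one {v : AbsoluteValue R ℝ} (hv : IsNonarchimedean v) (n : ℕ) :
    v (n : R) ≤ 1 :=
  hv.apply_natCast_le_one

theorem GaussLE.derivative {v : AbsoluteValue R ℝ} (hv : IsNonarchimedean v) {r : ℝ} (hr : 0 < r)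
    {f : PowerSeries R} {B : ℝ} (hf : GaussLE v r f (r * B)) :
    GaussLE v r (PowerSeries.derivative R f) B := by
  intro n
  have h1 := hf (n + 1)
  rw [PowerSeries.coeff_derivative, map_mul]
  have h2 := natCast_le_one hv (n + 1)
  push_cast at h2
  have h3 : v (PowerSeries.coeff (n + 1) f) * r ^ n ≤ B := by
    refine le_of_mul_le_mul_left ?_ hr
    calc _ = v (PowerSeries.coeff (n + 1) f) * r ^ (n + 1) := by ring
      _ ≤ _ := h1
  calc _ = v (n + 1 : R) * (v (PowerSeries.coeff (n + 1) f) * r ^ n) := by ring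
    _ ≤ 1 * (v (PowerSeries.coeff (n + 1) f) * r ^ n) :=
      mul_le_mul_of_nonneg_right h2 (mul_nonneg (v.nonneg _) (by positivity))
    _ ≤ B := by rwa [one_mul]

theorem IsEntire.derivative {v : AbsoluteValue R ℝ} (hv : IsNonarchimedean v)
    {f : PowerSeries R} (hf : IsEntire v f) : IsEntire v (PowerSeries.derivative R f) := by
  rw [isEntire_iff_bounded] at *
  intro r hr
  obtain ⟨C, hC, h⟩ := hf r hr
  refine ⟨C / r, by positivity, GaussLE.derivative hv hr ?_⟩
  rwa [mul_div_cancel₀ _ hr.ne']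

/-! ### The Pell equation -/

/-- Solutions of the Pell equation `x² - (t² - 1) y² = 1` satisfy `x' = y g` with an explicit
factor `g`. -/
theorem derivative_eq_mul_of_pell [CharZero R] {x y : PowerSeries R}
    (h : x ^ 2 - (PowerSeries.X ^ 2 - 1) * y ^ 2 = 1) :
    x * PowerSeries.derivative R x = y * (PowerSeries.X * y +
      (PowerSeries.X ^ 2 - 1) * PowerSeries.derivative R y) ∧
    PowerSeries.derivative R x = y * (x * (PowerSeries.X * y +
      (PowerSeries.X ^ 2 - 1) * PowerSeries.derivative R y) -
        (PowerSeries.X ^ 2 - 1) * y * PowerSeries.derivative R x) := by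
  have h1 := congrArg (PowerSeries.derivative R) h
  simp only [map_sub, Derivation.leibniz, Derivation.leibniz_pow, PowerSeries.derivative_X,
    PowerSeries.derivative_one, smul_eq_mul, nsmul_eq_mul] at h1
  have h2 : x * PowerSeries.derivative R x = y * (PowerSeries.X * y +
      (PowerSeries.X ^ 2 - 1) * PowerSeries.derivative R y) := by
    have h20 : (2 : PowerSeries R) ≠ 0 := by
      intro h
      have := congrArg (PowerSeries.coeff 0) h
      rw [← map_ofNat (PowerSeries.C (R := R)) 2, PowerSeries.coeff_zero_C] at this
      simp at this
    apply mul_left_cancel₀ h20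
    push_cast at h1
    linear_combination h1
  refine ⟨h2, ?_⟩
  linear_combination (x) * h2 - (PowerSeries.derivative R x) * h

theorem exists_derivative_eq_C_mul [CharZero R] {v : AbsoluteValue R ℝ} (hv : IsNonarchimedean v)
    {x y : PowerSeries R} (hx : IsEntire v x) (hy : IsEntire v y) (hy0 : y ≠ 0)
    (h : x ^ 2 - (PowerSeries.X ^ 2 - 1) * y ^ 2 = 1) :
    ∃ c : R, PowerSeries.derivative R x = PowerSeries.C c * y ∧
      PowerSeries.C c * x =
        PowerSeries.X * y + (PowerSeries.X ^ 2 - 1) * PowerSeries.derivative R y := by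
  obtain ⟨h1, h2⟩ := derivative_eq_mul_of_pell h
  set g := x * (PowerSeries.X * y +
      (PowerSeries.X ^ 2 - 1) * PowerSeries.derivative R y) -
        (PowerSeries.X ^ 2 - 1) * y * PowerSeries.derivative R x with hg
  have hgE : IsEntire v g := by
    let A := entireRing v hv
    have hX : PowerSeries.X ∈ A := (entireVar v hv).2
    have hX2 : (PowerSeries.X ^ 2 - 1 : PowerSeries R) ∈ A := sub_mem (pow_mem hX 2) (one_mem _)
    exact sub_mem (mul_mem hx (add_mem (mul_mem hX hy) (mul_mem hX2 (hy.derivative hv))))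
      (mul_mem (mul_mem hX2 hy) (hx.derivative hv))
  obtain ⟨m, hm⟩ : ∃ m, PowerSeries.coeff m y ≠ 0 := by
    by_contra! h
    exact hy0 (PowerSeries.ext fun n => by simp [h n])
  have hm' := v.pos hm
  have key : ∀ r, max 1 (v (PowerSeries.coeff m y))⁻¹ ≤ r → GaussLE v r g 1 := by
    intro r hr
    have hr1 : 1 ≤ r := (le_max_left _ _).trans hr
    have hr0 : 0 < r := by linarith
    obtain ⟨j, hj⟩ := hy.exists_isDominant hy0 hr0
    set S := v (PowerSeries.coeff j y) * r ^ j with hS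
    have hS0 : 0 < S := mul_pos (v.pos hj.ne_zero) (by positivity)
    have hrS : 1 ≤ r * S := by
      have e1 : (v (PowerSeries.coeff m y))⁻¹ ≤ r := (le_max_right _ _).trans hr
      have e2 : 1 ≤ r * v (PowerSeries.coeff m y) := by
        rwa [inv_le_iff_one_le_mul₀ hm'] at e1
      have e3 : v (PowerSeries.coeff m y) ≤ S :=
        (le_mul_of_one_le_right hm'.le (one_le_pow₀ hr1)).trans (hj.le m)
      exact e2.trans (mul_le_mul_of_nonneg_left e3 hr0.le)
    have hone : ∀ B : ℝ, 1 ≤ B → GaussLE v r 1 B := by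
      intro B hB n
      rw [PowerSeries.coeff_one]
      split_ifs with h
      · simpa [h] using hB
      · simp; linarith
    have hX : GaussLE v r PowerSeries.X r := by
      intro n
      rw [PowerSeries.coeff_X]
      split_ifs with h
      · simp [h]
      · simp [hr0.le]
    have hX2 : GaussLE v r (PowerSeries.X ^ 2 - 1) (r * r) := by
      rw [sub_eq_add_neg, pow_two]
      refine (hX.mul hv hr0 hX).add hv hr0 fun n => ?_
      rw [map_neg, v.map_neg]
      exact hone (r * r) (by nlinarith) n
    have hxx : GaussLE v r (x * x) ((r * S) * (r * S)) := by
      have e : x * x = 1 + (PowerSeries.X ^ 2 - 1) * (y * y) := by linear_combination h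
      rw [e]
      refine (hone _ (by nlinarith)).add hv hr0 ?_
      have := hX2.mul hv hr0 (hj.le.mul hv hr0 hj.le)
      rwa [← mul_mul_mul_comm] at this
    have hxB : GaussLE v r x (r * S) := by
      by_cases hx0 : x = 0
      · intro n
        simp [hx0]
        positivity
      obtain ⟨i, hi⟩ := hx.exists_isDominant hx0 hr0
      have := hi.mul_le hv hr0 hi hxx
      exact fun n => (hi.le n).trans (abs_le_of_sq_le_sq' (by nlinarith) (by positivity)).2
    have hd := hxB.derivative hv hr0
    by_cases hg0 : g = 0
    · intro n
      simp [hg0]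
    obtain ⟨k, hk⟩ := hgE.exists_isDominant hg0 hr0
    rw [h2] at hd
    have := hj.mul_le hv hr0 hk hd
    intro n
    refine (hk.le n).trans ?_
    exact le_of_mul_le_mul_left (by rw [mul_one]; exact this) hS0
  have hgC := eq_C_of_gaussLE_one key
  set c := PowerSeries.coeff 0 g
  refine ⟨c, by rw [h2, hgC, mul_comm], ?_⟩
  apply mul_left_cancel₀ hy0
  rw [hgC] at h2
  linear_combination h1 - x * h2

end Derivative

/-! ### The parameter of the differential equation is an even integer -/

section Arithmetic

variable {R : Type u} [CommRing R] [IsDomain R]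

/-- A non-Archimedean absolute value in characteristic zero decays at most exponentially along
the positive integers. -/
theorem exists_pow_le_natCast [CharZero R] {v : AbsoluteValue R ℝ} (hv : IsNonarchimedean v) :
    ∃ δ : ℝ, 0 < δ ∧ δ ≤ 1 ∧ ∀ N : ℕ, 0 < N → δ ^ N ≤ v (N : R) := by
  classical
  by_cases h : ∃ n : ℕ, 0 < n ∧ v (n : R) < 1
  swap
  · push Not at h
    exact ⟨1, one_pos, le_rfl, fun N hN => by simpa using h N hN⟩
  set p := Nat.find h with hp
  obtain ⟨hp0, hp1⟩ := Nat.find_spec h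
  rw [← hp] at hp0 hp1
  have hpos : 0 < v (p : R) := v.pos (Nat.cast_ne_zero.2 hp0.ne')
  have hp2 : 2 ≤ p := by
    rcases Nat.lt_or_ge p 2 with h2 | h2
    · have : p = 1 := by omega
      simp [this] at hp1
    · exact h2
  refine ⟨v (p : R), hpos, hp1.le, fun N => ?_⟩
  induction N using Nat.strong_induction_on with
  | _ N ih =>
    intro hN
    have hdiv := Nat.div_add_mod N p
    set q := N / p
    by_cases hr : N % p = 0
    · rw [hr, add_zero] at hdiv
      have hq : 0 < q := Nat.pos_of_ne_zero fun h0 => by simp [h0] at hdiv; omega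
      have hqN : q + 1 ≤ N := by nlinarith
      calc v (p : R) ^ N ≤ v (p : R) ^ (q + 1) := pow_le_pow_of_le_one hpos.le hp1.le hqN
        _ = v (p : R) * v (p : R) ^ q := pow_succ' _ _
        _ ≤ v (p : R) * v (q : R) := mul_le_mul_of_nonneg_left (ih q (by omega) hq) hpos.le
        _ = v (N : R) := by rw [← map_mul, ← Nat.cast_mul, hdiv]
    · have h1 : 1 ≤ v ((N % p : ℕ) : R) := by
        have := Nat.find_min h (Nat.mod_lt N hp0)
        push Not at this
        exact this (Nat.pos_of_ne_zero hr)
      have h2 : v (-((p * q : ℕ) : R)) < 1 := by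
        rw [v.map_neg, Nat.cast_mul, map_mul]
        exact (mul_le_of_le_one_right hpos.le (natCast_le_one hv q)).trans_lt hp1
      have h3 := hv (N : R) (-((p * q : ℕ) : R))
      have h4 : (N : R) + -((p * q : ℕ) : R) = ((N % p : ℕ) : R) := by
        nth_rw 1 [← hdiv]
        push_cast
        ring
      rw [h4] at h3
      have h5 : 1 ≤ v (N : R) := (le_max_iff.1 (h1.trans h3)).resolve_right h2.not_ge
      exact (pow_le_one₀ hpos.le hp1.le).trans h5

theorem natCast_le_of_dvd {v : AbsoluteValue R ℝ} (hv : IsNonarchimedean v) {m n : ℕ}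
    (h : m ∣ n) : v (n : R) ≤ v (m : R) := by
  obtain ⟨k, rfl⟩ := h
  rw [Nat.cast_mul, map_mul]
  exact mul_le_of_le_one_right (v.nonneg _) (natCast_le_one hv k)

/-- Lower bound for `∏ (z - 2 i)`, `0 ≤ i ≤ N`, in terms of its least factor. -/
theorem exists_le_prod_sub {v : AbsoluteValue R ℝ} (hv : IsNonarchimedean v) (z : R) (N : ℕ) :
    ∃ s ≤ N, v (z - 2 * s) * (v 2 ^ N * v (N.factorial : R)) ≤
      ∏ i ∈ Finset.range (N + 1), v (z - 2 * i) := by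
  obtain ⟨s, hs, hmin⟩ := (Finset.range (N + 1)).exists_min_image
    (fun i : ℕ => v (z - 2 * i)) ⟨0, by simp⟩
  have hsN : s ≤ N := by simpa [Nat.lt_succ_iff] using hs
  refine ⟨s, hsN, ?_⟩
  obtain ⟨w, rfl⟩ := Nat.exists_eq_add_of_le hsN
  have hfar : ∀ i k : ℕ, i < s + w + 1 → (i + k = s ∨ s + k = i) →
      v 2 * v (k : R) ≤ v (z - 2 * i) := by
    intro i k hi hk
    have h1 := hmin i (Finset.mem_range.2 hi)
    rw [← map_mul]
    rcases hk with rfl | rfl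
    · have e : (2 : R) * k = (z - 2 * i) + -(z - 2 * (i + k : ℕ)) := by push_cast; ring
      rw [e]
      refine (hv _ _).trans (max_le le_rfl ?_)
      rwa [v.map_neg]
    · have e : (2 : R) * k = (z - 2 * s) + -(z - 2 * (s + k : ℕ)) := by push_cast; ring
      rw [e]
      refine (hv _ _).trans (max_le h1 ?_)
      rw [v.map_neg]
  have hfact : ∀ n : ℕ, v 2 ^ n * v (n.factorial : R) =
      ∏ i ∈ Finset.range n, v 2 * v ((i + 1 : ℕ) : R) := by
    intro n
    rw [Finset.prod_mul_distrib, Finset.prod_const, Finset.card_range, ← map_prod,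
      ← Nat.cast_prod, Finset.prod_range_add_one_eq_factorial]
  have hlow : v 2 ^ s * v (s.factorial : R) ≤ ∏ i ∈ Finset.range s, v (z - 2 * i) := by
    rw [hfact, ← Finset.prod_range_reflect (fun i : ℕ => v (z - 2 * i))]
    refine Finset.prod_le_prod (fun i _ => by positivity) fun i hi => ?_
    have := Finset.mem_range.1 hi
    exact hfar _ _ (by omega) (Or.inl (by omega))
  have hup : v 2 ^ w * v (w.factorial : R) ≤
      ∏ i ∈ Finset.range w, v (z - 2 * (s + (i + 1) : ℕ)) := by
    rw [hfact]
    refine Finset.prod_le_prod (fun i _ => by positivity) fun i hi => ?_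
    have := Finset.mem_range.1 hi
    exact hfar _ _ (by omega) (Or.inr rfl)
  rw [add_assoc, Finset.prod_range_add, Finset.prod_range_succ']
  have hdvd : v ((s + w).factorial : R) ≤ v (s.factorial : R) * v (w.factorial : R) := by
    rw [← map_mul, ← Nat.cast_mul]
    exact natCast_le_of_dvd hv (Nat.factorial_mul_factorial_dvd_factorial_add s w)
  calc v (z - 2 * s) * (v 2 ^ (s + w) * v ((s + w).factorial : R))
      ≤ v (z - 2 * s) * (v 2 ^ (s + w) * (v (s.factorial : R) * v (w.factorial : R))) := by
        gcongr
    _ = (v 2 ^ s * v (s.factorial : R)) * ((v 2 ^ w * v (w.factorial : R)) * v (z - 2 * s)) := by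
        rw [pow_add]; ring
    _ ≤ _ := by
        simp only [add_zero]
        gcongr

theorem prod_sq_sub_sq {S : Type*} [CommRing S] (c : S) (m : ℕ) :
    ∏ j ∈ Finset.range (m + 1), ((2 * j : S) ^ 2 - c ^ 2) =
      (-1) ^ (m + 1) * (c * ∏ i ∈ Finset.range (2 * m + 1), (c + 2 * m - 2 * i)) := by
  induction m with
  | zero => simp; ring
  | succ m ih =>
    rw [Finset.prod_range_succ, ih, show 2 * (m + 1) + 1 = (2 * m + 1) + 1 + 1 by ring,
      Finset.prod_range_succ _ (2 * m + 1 + 1), Finset.prod_range_succ' _ (2 * m + 1)]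
    have : ∀ i : ℕ, c + 2 * ((m + 1 : ℕ) : S) - 2 * ((i + 1 : ℕ) : S) = c + 2 * m - 2 * i := by
      intro i; push_cast; ring
    simp only [this]
    push_cast
    ring

/-- If the recurrence of the Chebyshev equation with parameter `c` has a solution of infinite
radius of convergence with `a 0 ≠ 0`, then `c` is an even integer. -/
theorem exists_eq_two_mul_of_recurrence [CharZero R] {v : AbsoluteValue R ℝ}
    (hv : IsNonarchimedean v) {a : ℕ → R} {c : R} (h0 : v (a 0) = 1)
    (hrec : ∀ n : ℕ, ((n : R) + 1) * (n + 2) * a (n + 2) = ((n : R) ^ 2 - c ^ 2) * a n)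
    (hdecay : ∀ r : ℝ, 0 < r → ∃ C : ℝ, 0 ≤ C ∧ ∀ n : ℕ, v (a n) * r ^ n ≤ C) :
    ∃ j : ℤ, c = 2 * j := by
  by_cases hc : c = 0
  · exact ⟨0, by simp [hc]⟩
  have hc' : 0 < v c := v.pos hc
  have h2 : 0 < v (2 : R) := v.pos two_ne_zero
  have h21 : v (2 : R) ≤ 1 := by simpa using natCast_le_one hv 2
  obtain ⟨δ, hδ0, hδ1, hδ⟩ := exists_pow_le_natCast (R := R) hv
  have hprod : ∀ k : ℕ, a (2 * k) * ((2 * k).factorial : R) =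
      a 0 * ∏ j ∈ Finset.range k, ((2 * j : R) ^ 2 - c ^ 2) := by
    intro k
    induction k with
    | zero => simp
    | succ k ih =>
      have hk := hrec (2 * k)
      rw [Finset.prod_range_succ, ← mul_assoc, ← ih, show 2 * (k + 1) = 2 * k + 1 + 1 by ring,
        Nat.factorial_succ, Nat.factorial_succ]
      push_cast at hk ⊢
      linear_combination ((2 * k).factorial : R) * hk
  have happrox : ∀ m : ℕ, ∃ j : ℤ, |j| ≤ m ∧
      v (c - 2 * j) * (v c * v 2 ^ (2 * m)) ≤ v (a (2 * m + 2)) := by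
    intro m
    obtain ⟨s, hs, hle⟩ := exists_le_prod_sub hv (c + 2 * m) (2 * m)
    refine ⟨(s : ℤ) - m, abs_le.2 ⟨by omega, by omega⟩, ?_⟩
    have h1 := congrArg v (hprod (m + 1))
    rw [prod_sq_sub_sq, map_mul, map_mul, map_mul, map_mul, map_pow, v.map_neg, map_one, one_pow,
      h0, one_mul, one_mul, map_prod] at h1
    have hf : 0 < v ((2 * m).factorial : R) := v.pos (Nat.cast_ne_zero.2 (Nat.factorial_ne_zero _))
    have hdvd : v ((2 * (m + 1)).factorial : R) ≤ v ((2 * m).factorial : R) :=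
      natCast_le_of_dvd hv (Nat.factorial_dvd_factorial (by omega))
    refine le_of_mul_le_mul_right ?_ hf
    have e : c - 2 * (((s : ℤ) - m : ℤ) : R) = c + 2 * m - 2 * s := by push_cast; ring
    rw [e]
    calc _ = v c * (v (c + 2 * m - 2 * s) * (v 2 ^ (2 * m) * v ((2 * m).factorial : R))) := by ring
      _ ≤ _ := mul_le_mul_of_nonneg_left hle hc'.le
      _ = _ := h1.symm
      _ ≤ _ := mul_le_mul_of_nonneg_left hdvd (v.nonneg _)
  choose j hj hjle using happrox
  obtain ⟨C, hC0, hC⟩ := hdecay (2 / (v 2 * δ)) (by positivity)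
  have hr1 : 1 ≤ 2 / (v (2 : R) * δ) := by
    rw [one_le_div (by positivity)]
    nlinarith
  set D := C / v c with hD
  have hD0 : 0 ≤ D := by positivity
  have hclose : ∀ m, v (c - 2 * j m) ≤ D * (δ ^ 2 / 4) ^ m := by
    intro m
    have h1 := hC (2 * m + 2)
    have h3 : v (a (2 * m + 2)) * (2 / (v 2 * δ)) ^ (2 * m) ≤ C := by
      refine le_trans (mul_le_mul_of_nonneg_left ?_ (v.nonneg _)) h1
      exact pow_le_pow_right₀ hr1 (by omega)
    have h4 := (mul_le_mul_of_nonneg_right (hjle m)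
      (show 0 ≤ (2 / (v (2 : R) * δ)) ^ (2 * m) by positivity)).trans h3
    have e : v (c - 2 * j m) * (v c * v 2 ^ (2 * m)) * (2 / (v 2 * δ)) ^ (2 * m) =
        v (c - 2 * j m) * v c / (δ ^ 2 / 4) ^ m := by
      rw [div_pow, mul_pow, div_pow, pow_mul 2 2 m, pow_mul δ 2 m]
      field_simp
      norm_num
    rw [e, div_le_iff₀ (by positivity)] at h4
    rw [hD, div_mul_eq_mul_div, le_div_iff₀ hc']
    exact h4
  have hlim : Tendsto (fun m : ℕ => D * (1 / 4 : ℝ) ^ m) atTop (𝓝 0) := by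
    simpa using (tendsto_pow_atTop_nhds_zero_of_lt_one (r := (1 / 4 : ℝ))
      (by norm_num) (by norm_num)).const_mul D
  obtain ⟨M, hM⟩ := eventually_atTop.1
    (hlim.eventually_lt_const (show 0 < v (2 : R) * δ by positivity))
  have hq1 : δ ^ 2 / 4 ≤ 1 := by nlinarith
  have hstep : ∀ m, M ≤ m → j (m + 1) = j m := by
    intro m hm
    by_contra hne
    set n := (j (m + 1) - j m).natAbs with hn
    have hn0 : 0 < n := Int.natAbs_pos.2 (sub_ne_zero.2 hne)
    have hn1 : n ≤ 2 * m + 1 := by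
      have e1 := abs_le.1 (hj m)
      have e2 := abs_le.1 (hj (m + 1))
      push_cast at e2
      omega
    have hvn : v (((j (m + 1) - j m : ℤ)) : R) = v (n : R) := by
      rcases Int.natAbs_eq (j (m + 1) - j m) with e | e
      · rw [e, ← hn]; simp
      · rw [e, ← hn]; simp
    have hlow : v 2 * δ ^ (2 * m + 1) ≤ v (2 * ((j (m + 1) - j m : ℤ) : R)) := by
      rw [map_mul, hvn]
      exact mul_le_mul_of_nonneg_left
        ((pow_le_pow_of_le_one hδ0.le hδ1 hn1).trans (hδ n hn0)) h2.le
    have hupp : v (2 * ((j (m + 1) - j m : ℤ) : R)) ≤ D * (δ ^ 2 / 4) ^ m := by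
      have e : 2 * ((j (m + 1) - j m : ℤ) : R) = (c - 2 * j m) + -(c - 2 * j (m + 1)) := by
        push_cast; ring
      rw [e]
      refine (hv _ _).trans (max_le (hclose m) ?_)
      rw [v.map_neg]
      exact (hclose (m + 1)).trans (mul_le_mul_of_nonneg_left
        (pow_le_pow_of_le_one (by positivity) hq1 (by omega)) hD0)
    have h5 := hlow.trans hupp
    have e1 : v 2 * δ ^ (2 * m + 1) = (v 2 * δ) * δ ^ (2 * m) := by ring
    have e2 : D * (δ ^ 2 / 4) ^ m = (D * (1 / 4) ^ m) * δ ^ (2 * m) := by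
      rw [div_pow, one_div_pow, pow_mul]; ring
    rw [e1, e2] at h5
    exact (hM m hm).not_ge (le_of_mul_le_mul_right h5 (by positivity))
  have hconst : ∀ m, M ≤ m → j m = j M := by
    intro m hm
    induction m, hm using Nat.le_induction with
    | base => rfl
    | succ m hm ih => rw [hstep m hm, ih]
  refine ⟨j M, sub_eq_zero.1 ((v.eq_zero).1 (le_antisymm ?_ (v.nonneg _)))⟩
  refine ge_of_tendsto hlim (eventually_atTop.2 ⟨M, fun m hm => ?_⟩)
  rw [← hconst m hm]
  refine (hclose m).trans (mul_le_mul_of_nonneg_left ?_ hD0)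
  exact pow_le_pow_left₀ (by positivity) (by nlinarith) m

end Arithmetic

/-! ### The domain of the interpretation -/

section Domain

/-- Congruence modulo `t - 1`, written without subtraction. -/
def CongrAtOne {A : Type*} [Add A] [Mul A] (t a b : A) : Prop :=
  ∃ g, a + g = b + t * g

/-- The `y`-parts of those solutions of the Pell equation over `t` that satisfy `x(1) = 1` and
`y(0) = 0`. -/
def IsPellEven {A : Type*} [One A] [Add A] [Mul A] (t y : A) : Prop :=
  ∃ x h w, x + h = 1 + t * h ∧ y = t * w ∧ x * x + y * y = 1 + (t * y) * (t * y)

variable {A : Type*} [CommRing A] {t : A}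

theorem congrAtOne_iff {a b : A} : CongrAtOne t a b ↔
    Ideal.Quotient.mk (Ideal.span {t - 1}) a = Ideal.Quotient.mk (Ideal.span {t - 1}) b := by
  rw [Ideal.Quotient.eq, Ideal.mem_span_singleton]
  constructor
  · rintro ⟨g, h⟩
    exact ⟨g, by linear_combination h⟩
  · rintro ⟨g, h⟩
    exact ⟨g, by linear_combination h⟩

theorem IsPellEven.neg {y : A} (hy : IsPellEven t y) : IsPellEven t (-y) := by
  obtain ⟨x, h, w, h1, h2, h3⟩ := hy
  exact ⟨x, h, -w, h1, by rw [h2, mul_neg], by linear_combination h3⟩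

theorem exists_isPellEven_natCast (t : A) (n : ℕ) :
    ∃ y x h w g : A, x + h = 1 + t * h ∧ y = t * w ∧ x * x + y * y = 1 + (t * y) * (t * y) ∧
      y + g = 2 * n + t * g := by
  induction n with
  | zero => exact ⟨0, 1, 0, 0, 0, by simp⟩
  | succ n ih =>
    obtain ⟨y, x, h, w, g, h1, h2, h3, h4⟩ := ih
    refine ⟨2 * t * x + (2 * t ^ 2 - 1) * y, (2 * t ^ 2 - 1) * x + 2 * t * (t ^ 2 - 1) * y,
      (2 * t ^ 2 - 1) * h + 2 * (t + 1) + 2 * t * (t + 1) * y, 2 * x + (2 * t ^ 2 - 1) * w,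
      2 * x + 2 * h + 2 * (t + 1) * y + g, ?_, ?_, ?_, ?_⟩
    · linear_combination (2 * t ^ 2 - 1) * h1
    · linear_combination (2 * t ^ 2 - 1) * h2
    · linear_combination h3
    · push_cast
      linear_combination h4 + 2 * h1

theorem exists_isPellEven (t : A) (n : ℤ) :
    ∃ y, IsPellEven t y ∧ CongrAtOne t y ((2 * n : ℤ) : A) := by
  obtain ⟨m, rfl | rfl⟩ := n.eq_nat_or_neg
  · obtain ⟨y, x, h, w, g, h1, h2, h3, h4⟩ := exists_isPellEven_natCast t m
    exact ⟨y, ⟨x, h, w, h1, h2, h3⟩, g, by simpa using h4⟩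
  · obtain ⟨y, x, h, w, g, h1, h2, h3, h4⟩ := exists_isPellEven_natCast t m
    refine ⟨-y, IsPellEven.neg ⟨x, h, w, h1, h2, h3⟩, -g, ?_⟩
    push_cast
    linear_combination -h4

theorem coeff_recurrence {R : Type*} [CommRing R] {x y : PowerSeries R} {c : R}
    (h1 : PowerSeries.derivative R x = PowerSeries.C c * y)
    (h2 : PowerSeries.C c * x =
      PowerSeries.X * y + (PowerSeries.X ^ 2 - 1) * PowerSeries.derivative R y) (n : ℕ) :
    ((n : R) + 1) * (n + 2) * PowerSeries.coeff (n + 2) x =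
      ((n : R) ^ 2 - c ^ 2) * PowerSeries.coeff n x := by
  have e1 : ∀ k : ℕ, PowerSeries.coeff (k + 1) x * ((k : R) + 1) = c * PowerSeries.coeff k y := by
    intro k
    have := congrArg (PowerSeries.coeff k) h1
    rwa [PowerSeries.coeff_derivative, PowerSeries.coeff_C_mul] at this
  have h2' : PowerSeries.C c * x + PowerSeries.derivative R y =
      PowerSeries.X * (y + PowerSeries.X * PowerSeries.derivative R y) := by
    linear_combination h2
  have e2 := congrArg (PowerSeries.coeff n) h2'
  rw [map_add, PowerSeries.coeff_C_mul, PowerSeries.coeff_derivative] at e2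
  have e3 := e1 (n + 1)
  push_cast at e3
  rcases n with _ | n
  · rw [PowerSeries.coeff_zero_X_mul] at e2
    norm_num at e2 e3 ⊢
    linear_combination e3 + c * e2
  · rw [PowerSeries.coeff_succ_X_mul, map_add] at e2
    have e4 := e1 n
    rcases n with _ | n
    · rw [PowerSeries.coeff_zero_X_mul] at e2
      norm_num at e2 e3 e4 ⊢
      linear_combination 2 * e3 + c * e2 - e4
    · rw [PowerSeries.coeff_succ_X_mul, PowerSeries.coeff_derivative] at e2
      push_cast at e2 e3 e4 ⊢
      linear_combination ((n : R) + 3) * e3 + c * e2 - ((n : R) + 2) * e4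

variable {R : Type u} [CommRing R] [IsDomain R] [CharZero R]

theorem IsPellEven.exists_congrAtOne {v : AbsoluteValue R ℝ} {hv : IsNonarchimedean v}
    {y : entireRing v hv} (hy : IsPellEven (entireVar v hv) y) :
    ∃ n : ℤ, CongrAtOne (entireVar v hv) y ((2 * n : ℤ) : entireRing v hv) := by
  obtain ⟨x, h, w, h1, h2, h3⟩ := hy
  by_cases hy0 : y = 0
  · exact ⟨0, 0, by simp [hy0]⟩
  have h3' := congrArg Subtype.val h3
  have h2' := congrArg Subtype.val h2
  change (x : PowerSeries R) * (x : PowerSeries R) + (y : PowerSeries R) * (y : PowerSeries R) =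
    1 + (PowerSeries.X * (y : PowerSeries R)) * (PowerSeries.X * (y : PowerSeries R)) at h3'
  change (y : PowerSeries R) = PowerSeries.X * (w : PowerSeries R) at h2'
  obtain ⟨c, hc1, hc2⟩ := exists_derivative_eq_C_mul hv x.2 y.2
    (fun e => hy0 (Subtype.ext e)) (by linear_combination h3')
  have hx0 : v (PowerSeries.coeff 0 (x : PowerSeries R)) = 1 := by
    have e := congrArg PowerSeries.constantCoeff h3'
    rw [h2'] at e
    simp only [map_add, map_mul, PowerSeries.constantCoeff_X, map_one, zero_mul, add_zero] at e
    rw [PowerSeries.coeff_zero_eq_constantCoeff_apply]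
    rcases mul_self_eq_one_iff.1 e with e | e <;> simp [e]
  obtain ⟨j, rfl⟩ := exists_eq_two_mul_of_recurrence hv hx0 (coeff_recurrence hc1 hc2)
    ((isEntire_iff_bounded v _).1 x.2)
  let dy : entireRing v hv := ⟨_, IsEntire.derivative hv y.2⟩
  have hc3 : ((2 * j : ℤ) : entireRing v hv) * x =
      entireVar v hv * y + (entireVar v hv ^ 2 - 1) * dy := by
    apply Subtype.ext
    change (((2 * j : ℤ) : entireRing v hv) : PowerSeries R) * (x : PowerSeries R) =
      PowerSeries.X * (y : PowerSeries R) +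
        (PowerSeries.X ^ 2 - 1) * PowerSeries.derivative R (y : PowerSeries R)
    rw [← hc2, show (2 * j : R) = ((2 * j : ℤ) : R) by push_cast; rfl, map_intCast]
    congr 1
  refine ⟨j, ((2 * j : ℤ) : entireRing v hv) * h - (entireVar v hv + 1) * dy - y, ?_⟩
  linear_combination ((2 * j : ℤ) : entireRing v hv) * h1 - hc3

instance charZero_quotient (v : AbsoluteValue R ℝ) (hv : IsNonarchimedean v) :
    CharZero (entireRing v hv ⧸ Ideal.span {entireVar v hv - 1}) := by
  refine charZero_of_inj_zero fun n hn => ?_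
  rw [← map_natCast (Ideal.Quotient.mk _), Ideal.Quotient.eq_zero_iff_mem,
    Ideal.mem_span_singleton] at hn
  obtain ⟨g, hg⟩ := hn
  have hg' : (n : PowerSeries R) + (g : PowerSeries R) = PowerSeries.X * (g : PowerSeries R) := by
    have := congrArg Subtype.val hg
    change ((n : entireRing v hv) : PowerSeries R) = (PowerSeries.X - 1) * (g : PowerSeries R) at this
    rw [Subring.coe_natCast] at this
    linear_combination this
  have hcoeff : ∀ k, PowerSeries.coeff k (g : PowerSeries R) = -(n : R) := by
    intro k
    induction k with
    | zero =>
      have := congrArg (PowerSeries.coeff 0) hg'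
      rw [map_add, PowerSeries.coeff_zero_X_mul, ← map_natCast (PowerSeries.C (R := R)),
        PowerSeries.coeff_zero_C] at this
      linear_combination this
    | succ k ih =>
      have := congrArg (PowerSeries.coeff (k + 1)) hg'
      rw [map_add, PowerSeries.coeff_succ_X_mul, ← map_natCast (PowerSeries.C (R := R)),
        PowerSeries.coeff_C, if_neg (by omega), ih] at this
      linear_combination this
  have hlim := (show IsEntire v (g : PowerSeries R) from g.2) 1 one_pos
  simp only [hcoeff, one_pow, mul_one, v.map_neg] at hlim
  have := tendsto_nhds_unique hlim tendsto_const_nhds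
  simpa using this.symm

end Domain

/-! ### Formulas -/

section Formulas

variable {β : Type*}

/-- The term `1`. -/
def oneTerm : tLang.Term β := Term.func (L := tLang) TFunc.one Fin.elim0

/-- The term `0`. -/
def zeroTerm : tLang.Term β := Term.func (L := tLang) TFunc.zero Fin.elim0

/-- The term `t`. -/
def tTerm : tLang.Term β := Term.func (L := tLang) TFunc.t Fin.elim0

/-- The sum of two terms. -/
def addTerm (a b : tLang.Term β) : tLang.Term β := Term.func (L := tLang) TFunc.add ![a, b]

/-- The product of two terms. -/
def mulTerm (a b : tLang.Term β) : tLang.Term β := Term.func (L := tLang) TFunc.mul ![a, b]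

/-- The formula expressing `CongrAtOne`. -/
def congrFormula (a b : tLang.Term β) : tLang.Formula β :=
  BoundedFormula.ex (n := 0) <|
    (addTerm (a.relabel Sum.inl) (Term.var (Sum.inr 0))).bdEqual
      (addTerm (b.relabel Sum.inl) (mulTerm tTerm (Term.var (Sum.inr 0))))

/-- The formula expressing `IsPellEven`. -/
def pellFormula (i : β) : tLang.Formula β :=
  let y : tLang.Term (β ⊕ Fin 3) := Term.var (Sum.inl i)
  let x : tLang.Term (β ⊕ Fin 3) := Term.var (Sum.inr 0)
  let h : tLang.Term (β ⊕ Fin 3) := Term.var (Sum.inr 1)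
  let w : tLang.Term (β ⊕ Fin 3) := Term.var (Sum.inr 2)
  BoundedFormula.ex (n := 0) <| BoundedFormula.ex <| BoundedFormula.ex <|
    (addTerm x h).bdEqual (addTerm oneTerm (mulTerm tTerm h)) ⊓
    (y.bdEqual (mulTerm tTerm w) ⊓
    (addTerm (mulTerm x x) (mulTerm y y)).bdEqual
      (addTerm oneTerm (mulTerm (mulTerm tTerm y) (mulTerm tTerm y))))

theorem isPositiveExistential_congrFormula (a b : tLang.Term β) :
    IsPositiveExistential (congrFormula a b) :=
  .ex (.atomic (.equal _ _))

theorem isPositiveExistential_pellFormula (i : β) : IsPositiveExistential (pellFormula i) :=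
  .ex (.ex (.ex (.and (.atomic (.equal _ _))
    (.and (.atomic (.equal _ _)) (.atomic (.equal _ _))))))

/-- The formulas of the interpretation. -/
def intFormulas : InterpretationFormulas arithLang tLang where
  domain := pellFormula 0
  eq := (pellFormula 0 ⊓ pellFormula 1) ⊓ congrFormula (Term.var 0) (Term.var 1)
  func := fun {_} f => match f with
    | ArithFunc.zero => pellFormula 0 ⊓ congrFormula (Term.var 0) zeroTerm
    | ArithFunc.one => pellFormula 0 ⊓ congrFormula (Term.var 0) (addTerm oneTerm oneTerm)
    | ArithFunc.add => (pellFormula 0 ⊓ (pellFormula 1 ⊓ pellFormula 2)) ⊓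
        congrFormula (addTerm (Term.var 0) (Term.var 1)) (Term.var 2)
    | ArithFunc.mul => (pellFormula 0 ⊓ (pellFormula 1 ⊓ pellFormula 2)) ⊓
        congrFormula (mulTerm (Term.var 0) (Term.var 1))
          (mulTerm (addTerm oneTerm oneTerm) (Term.var 2))
  rel := fun {_} r => Empty.elim r

theorem isPosEx_intFormulas : intFormulas.IsPosEx where
  domain := isPositiveExistential_pellFormula 0
  eq := .and (.and (isPositiveExistential_pellFormula _) (isPositiveExistential_pellFormula _))
    (isPositiveExistential_congrFormula _ _)
  func := fun {_} f => match f with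
    | ArithFunc.zero =>
      .and (isPositiveExistential_pellFormula _) (isPositiveExistential_congrFormula _ _)
    | ArithFunc.one =>
      .and (isPositiveExistential_pellFormula _) (isPositiveExistential_congrFormula _ _)
    | ArithFunc.add =>
      .and (.and (isPositiveExistential_pellFormula _)
        (.and (isPositiveExistential_pellFormula _) (isPositiveExistential_pellFormula _)))
        (isPositiveExistential_congrFormula _ _)
    | ArithFunc.mul =>
      .and (.and (isPositiveExistential_pellFormula _)
        (.and (isPositiveExistential_pellFormula _) (isPositiveExistential_pellFormula _)))
        (isPositiveExistential_congrFormula _ _)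
  rel := fun {_} r => Empty.elim r

end Formulas

section Realize

variable {R : Type u} [CommRing R] {v : AbsoluteValue R ℝ} {hv : IsNonarchimedean v}
  {β : Type*} (e : β → entireRing v hv)

theorem realize_oneTerm : (oneTerm : tLang.Term β).realize e = 1 := rfl

theorem realize_zeroTerm : (zeroTerm : tLang.Term β).realize e = 0 := rfl

theorem realize_tTerm : (tTerm : tLang.Term β).realize e = entireVar v hv := rfl

theorem realize_addTerm (a b : tLang.Term β) :
    (addTerm a b).realize e = a.realize e + b.realize e := rfl

theorem realize_mulTerm (a b : tLang.Term β) :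
    (mulTerm a b).realize e = a.realize e * b.realize e := rfl

theorem realize_congrFormula (a b : tLang.Term β) :
    (congrFormula a b).Realize e ↔
      CongrAtOne (entireVar v hv) (a.realize e) (b.realize e) := by
  simp [Formula.Realize, congrFormula, BoundedFormula.realize_ex, realize_addTerm,
    realize_mulTerm, realize_tTerm, CongrAtOne, Term.realize_relabel, Function.comp_def, Fin.snoc]

theorem realize_pellFormula (i : β) :
    (pellFormula i).Realize e ↔ IsPellEven (entireVar v hv) (e i) := by
  simp [Formula.Realize, pellFormula, BoundedFormula.realize_ex, realize_addTerm,
    realize_mulTerm, realize_tTerm, realize_oneTerm, IsPellEven, Fin.snoc]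

theorem mem_domainSet_intFormulas (y : entireRing v hv) :
    y ∈ intFormulas.domainSet (entireRing v hv) ↔ IsPellEven (entireVar v hv) y :=
  realize_pellFormula ![y] 0

end Realize

/-! ### The interpretation -/

section Interpretation

variable {R : Type u} [CommRing R] [IsDomain R] [CharZero R]

theorem exists_interprets (v : AbsoluteValue R ℝ) (hv : IsNonarchimedean v) :
    ∃ θ : intFormulas.domainSet (entireRing v hv) → ℤ, intFormulas.Interprets θ := by
  let π := Ideal.Quotient.mk (Ideal.span {entireVar v hv - 1})
  have hex : ∀ y : intFormulas.domainSet (entireRing v hv), ∃ n : ℤ, π y = ((2 * n : ℤ) : _) := by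
    intro y
    obtain ⟨n, hn⟩ := ((mem_domainSet_intFormulas y.1).1 y.2).exists_congrAtOne
    exact ⟨n, by rw [← map_intCast π]; exact congrAtOne_iff.1 hn⟩
  choose θ hθ using hex
  have hθ' : ∀ y (h : y ∈ intFormulas.domainSet (entireRing v hv)),
      π y = ((2 * θ ⟨y, h⟩ : ℤ) : _) := fun y h => hθ ⟨y, h⟩
  have hinj : ∀ {n m : ℤ}, ((2 * n : ℤ) : entireRing v hv ⧸ Ideal.span {entireVar v hv - 1}) =
      ((2 * m : ℤ) : _) → n = m := by
    intro n m h
    have := Int.cast_injective h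
    omega
  refine ⟨θ, ⟨fun n => ?_, fun x => ?_, fun {k} f x => ?_, fun r => Empty.elim r⟩⟩
  · obtain ⟨y, hy, hn⟩ := exists_isPellEven (entireVar v hv) n
    refine ⟨⟨y, (mem_domainSet_intFormulas y).2 hy⟩, ?_⟩
    have h1 := congrAtOne_iff.1 hn
    rw [map_intCast] at h1
    exact hinj ((hθ' y ((mem_domainSet_intFormulas y).2 hy)).symm.trans h1)
  · simp only [intFormulas, Formula.realize_inf, realize_pellFormula, realize_congrFormula,
      Term.realize_var, ← mem_domainSet_intFormulas]
    change _ ↔ ∃ h : ∀ i, x i ∈ intFormulas.domainSet (entireRing v hv),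
      θ ⟨x 0, h 0⟩ = θ ⟨x 1, h 1⟩
    constructor
    · rintro ⟨⟨h0, h1⟩, h⟩
      refine ⟨Fin.forall_fin_two.2 ⟨h0, h1⟩, ?_⟩
      have h2 := congrAtOne_iff.1 h
      change π _ = π _ at h2
      rw [hθ' _ h0, hθ' _ h1] at h2
      exact hinj h2
    · rintro ⟨h, h'⟩
      refine ⟨⟨h 0, h 1⟩, congrAtOne_iff.2 ?_⟩
      change π _ = π _
      rw [hθ' _ (h 0), hθ' _ (h 1), h']
  · cases f with
    | zero =>
      simp only [intFormulas, Formula.realize_inf, realize_pellFormula, realize_congrFormula,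
        Term.realize_var, ← mem_domainSet_intFormulas, realize_zeroTerm]
      change _ ↔ ∃ h, (0 : ℤ) = θ ⟨x 0, h 0⟩
      constructor
      · rintro ⟨h0, h⟩
        refine ⟨Fin.forall_fin_one.2 h0, ?_⟩
        have h2 := congrAtOne_iff.1 h
        change π _ = π _ at h2
        rw [hθ' _ h0] at h2
        have := hinj (m := 0) (by simpa using h2)
        omega
      · rintro ⟨h, h'⟩
        refine ⟨h 0, congrAtOne_iff.2 ?_⟩
        change π _ = π _
        rw [hθ' _ (h 0), ← h']
        simp
    | one =>
      simp only [intFormulas, Formula.realize_inf, realize_pellFormula, realize_congrFormula,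
        Term.realize_var, ← mem_domainSet_intFormulas, realize_addTerm, realize_oneTerm]
      change _ ↔ ∃ h, (1 : ℤ) = θ ⟨x 0, h 0⟩
      constructor
      · rintro ⟨h0, h⟩
        refine ⟨Fin.forall_fin_one.2 h0, ?_⟩
        have h2 := congrAtOne_iff.1 h
        change π _ = π _ at h2
        rw [map_add, map_one, hθ' _ h0] at h2
        have := hinj (m := 1) (by simpa [one_add_one_eq_two] using h2)
        omega
      · rintro ⟨h, h'⟩
        refine ⟨h 0, congrAtOne_iff.2 ?_⟩
        change π _ = π _
        rw [map_add, map_one, hθ' _ (h 0), ← h']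
        simp [one_add_one_eq_two]
    | add =>
      simp only [intFormulas, Formula.realize_inf, realize_pellFormula, realize_congrFormula,
        Term.realize_var, ← mem_domainSet_intFormulas, realize_addTerm]
      change _ ↔ ∃ h, θ ⟨x 0, h 0⟩ + θ ⟨x 1, h 1⟩ = θ ⟨x 2, h 2⟩
      constructor
      · rintro ⟨⟨h0, h1, h2⟩, h⟩
        refine ⟨fun i => by fin_cases i <;> assumption, ?_⟩
        have h3 := congrAtOne_iff.1 h
        change π _ = π _ at h3
        rw [map_add, hθ' _ h0, hθ' _ h1, hθ' _ h2] at h3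
        refine hinj ?_
        push_cast at h3 ⊢
        linear_combination h3
      · rintro ⟨h, h'⟩
        refine ⟨⟨h 0, h 1, h 2⟩, congrAtOne_iff.2 ?_⟩
        change π _ = π _
        rw [map_add, hθ' _ (h 0), hθ' _ (h 1), hθ' _ (h 2), ← h']
        push_cast
        ring
    | mul =>
      simp only [intFormulas, Formula.realize_inf, realize_pellFormula, realize_congrFormula,
        Term.realize_var, ← mem_domainSet_intFormulas, realize_mulTerm, realize_addTerm, realize_oneTerm]
      change _ ↔ ∃ h, θ ⟨x 0, h 0⟩ * θ ⟨x 1, h 1⟩ = θ ⟨x 2, h 2⟩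
      constructor
      · rintro ⟨⟨h0, h1, h2⟩, h⟩
        refine ⟨fun i => by fin_cases i <;> assumption, ?_⟩
        have h3 := congrAtOne_iff.1 h
        change π _ = π _ at h3
        rw [map_mul, map_mul, map_add, map_one, hθ' _ h0, hθ' _ h1, hθ' _ h2] at h3
        have h4 : 2 * (2 * (θ ⟨x 0, h0⟩ * θ ⟨x 1, h1⟩)) = 2 * (2 * θ ⟨x 2, h2⟩) := by
          apply Int.cast_injective (α := entireRing v hv ⧸ Ideal.span {entireVar v hv - 1})
          push_cast at h3 ⊢
          linear_combination h3
        omega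
      · rintro ⟨h, h'⟩
        refine ⟨⟨h 0, h 1, h 2⟩, congrAtOne_iff.2 ?_⟩
        change π _ = π _
        rw [map_mul, map_mul, map_add, map_one, hθ' _ (h 0), hθ' _ (h 1), hθ' _ (h 2), ← h']
        push_cast
        ring

end Interpretation

theorem charZeroEntireClass_nonempty : charZeroEntireClass.{u}.Nonempty := by
  classical
  have hdom : IsDomain (ULift.{u} ℤ) := ULift.ringEquiv.toMulEquiv.isDomain ℤ
  have hchar : CharZero (ULift.{u} ℤ) :=
    ⟨fun a b h => by simpa using congrArg ULift.down h⟩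
  have hv : IsNonarchimedean (AbsoluteValue.trivial : AbsoluteValue (ULift.{u} ℤ) ℝ) := by
    intro a b
    by_cases hab : a + b = 0
    · simp [hab]
    rw [AbsoluteValue.trivial_apply hab, le_max_iff]
    by_cases ha : a = 0
    · exact Or.inr (AbsoluteValue.trivial_apply (by simpa [ha] using hab)).ge
    · exact Or.inl (AbsoluteValue.trivial_apply ha).ge
  exact ⟨_, ULift.{u} ℤ, inferInstance, hdom, hchar, _, hv, rfl⟩

end EntireInterp

theorem mainTheorem9 :
    EntireInterp.UniformlyPosExInterpretable.{u} (L := EntireInterp.arithLang)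
      (L' := EntireInterp.tLang) ℤ EntireInterp.charZeroEntireClass.{u} := by
  refine ⟨EntireInterp.charZeroEntireClass_nonempty, EntireInterp.intFormulas,
    EntireInterp.isPosEx_intFormulas, ?_⟩
  rintro _ ⟨R, _, _, _, v, hv, rfl⟩
  exact EntireInterp.exists_interprets v hv
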